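/- Let $\mathcal Q$ be a small quantaloid (a small category whose hom-sets are complete lattices and whose composition preserves arbitrary suprema in each variable) with object set $\mathcal Q_0$. A $\mathcal Q$-relation $r:X\nrightarrow Y$ between sets $X,Y$ over $\mathcal Q_0$ (with type maps $|\cdot|$) assigns to $x\in X$, $y\in Y$ a morphism $r(x,y):|x|\to|y|$; these compose by $(s\circ r)(x,z)=\bigvee_y s(y,z)\circ r(x,y)$, have identities $1^\circ_X$ (equal to $1_{|x|}$ on the diagonal, $\bot$ off it), and form the order-enriched category $\mathcal Q\text{-}\mathbf{Rel}$ with the pointwise order. For a map $f:X\to Y$ over $\mathcal Q_0$ put $f_\circ(x,y)=1_Y^\circ(fx,y)$ and $f^\circ(y,x)=1_Y^\circ(y,fx)$. A $\mathcal Q$-category is a set $X$ over $\mathcal Q_0$ with a $\mathcal Q$-relation $a:X\nrightarrow X$ such that $1_X^\circ\le a$ and $a\circ a\le a$; a $\mathcal Q$-functor $f:(X,a)\to(Y,b)$ is a map over $\mathcal Q_0$ with $a(x,x')\le b(fx,fx')$, fully faithful if equality holds; $f\le g$ means $1_{|x|}\le b(fx,gx)$ for all $x$. This gives the 2-category $\mathcal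 Q\text{-}\mathbf{Cat}$. A distributor $\varphi:(X,a)\to(Y,b)$ is a $\mathcal Q$-relation with $b\circ\varphi\circ a\le\varphi$; every $\mathcal Q$-functor $f:(X,a)\to(Y,b)$ has $f_*=b\circ f_\circ$ and $f^*=f^\circ\circ b$. The presheaf $\mathcal Q$-category $\mathcal PX$ consists of the distributors $\sigma:X\to\{s\}$, $s\in\mathcal Q_0$ (where $\{s\}$ is the one-object discrete $\mathcal Q$-category of type $s$), with type $|\sigma|=s$ and hom $(\sigma,\tau)\mapsto\tau\swarrow\sigma$, the largest $\alpha:|\sigma|\to|\tau|$ with $\alpha\circ\sigma\le\tau$. A distributor $\varphi:X\to Y$ has the transpose $\overleftarrow\varphi:Y\to\mathcal PX$, $y\mapsto\varphi(-,y)$, and the Yoneda $\mathcal Q$-functor is $\mathsf y_X=\overleftarrow{a}:X\to\mathcal PX$. The functor $o:\mathcal Q\text{-}\mathbf{Cat}\to\mathbf{Set}/\mathcal Q_0$, $(X,a)\mapsto X$, has the left adjoint $d:X\mapsto(X,1_X^\circ)$, with counit $\varepsilon$ given by identity maps; $\mathbf o$ sends a distributor to its underlying $\mathcal Q$-relation,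 and $\mathbf d$ views a $\mathcal Q$-relation $X\nrightarrow Y$ as a distributor $dX\to dY$. Let $\mathsf{ExtMnd}(\mathbf{Set}/\mathcal Q_0)$ be the category whose objects are monads $\mathbb T=(T,m,e)$ on $\mathbf{Set}/\mathcal Q_0$ equipped with a lax extension $\hat T$ to $\mathcal Q\text{-}\mathbf{Rel}$, that is, monotone maps $r\mapsto\hat Tr$ from the $\mathcal Q$-relations $X\nrightarrow Y$ to those $TX\nrightarrow TY$ with $1^\circ_{TX}\le\hat T1^\circ_X$, $\hat Ts\circ\hat Tr\le\hat T(s\circ r)$, $(Tf)_\circ\le\hat T(f_\circ)$, $(Tf)^\circ\le\hat T(f^\circ)$, $(m_Y)_\circ\circ\hat T\hat Tr\le\hat Tr\circ(m_X)_\circ$ and $(e_Y)_\circ\circ r\le\hat Tr\circ(e_X)_\circ$; morphisms $(\mathbb S,\hat S)\to(\mathbb T,\hat T)$ are monad morphisms $\lambda$ with $(\lambda_Y)_\circ\circ\hat Sr\le\hat Tr\circ(\lambda_X)_\circ$ for all $r:X\nrightarrow Y$. Let $\mathsf{ffYMnd}(\mathcal Q\text{-}\mathbf{Cat})$ be the full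 subcategory of the category of 2-monads on $\mathcal Q\text{-}\mathbf{Cat}$ and monad morphisms given by those $(\mathcal T,\mathsf m,\mathsf e)$ for which $\mathcal T\mathsf y_X$ is fully faithful for every $\mathcal Q$-category $X$. Let $\Delta':\mathsf{ExtMnd}(\mathbf{Set}/\mathcal Q_0)\to\mathsf{ffYMnd}(\mathcal Q\text{-}\mathbf{Cat})$ be the functor sending $(\mathbb T,\hat T)$ to the 2-monad with endofunctor $(X,a)\mapsto(TX,\hat Ta)$, $f\mapsto Tf$, and with the multiplication and unit carried by $m$ and $e$, and sending $\lambda$ to the monad morphism with components carried by $\lambda_X$ at $(X,a)$. Let $\Gamma':\mathsf{ffYMnd}(\mathcal Q\text{-}\mathbf{Cat})\to\mathsf{ExtMnd}(\mathbf{Set}/\mathcal Q_0)$ be the functor sending $(\mathcal T,\mathsf m,\mathsf e)$ to the monad $T=o\mathcal Td$, $m=o\mathsf md\cdot o\mathcal T\varepsilon\mathcal Td$, $e=o\mathsf ed$ with the lax extension $\mathbf o\overline{\mathcal T}\mathbf d$, where $\overline{\mathcal T}\varphi=(\mathcal T\overleftarrow\varphi)^*\circ(\mathcal T\mathsf y_X)_*$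 for a distributor $\varphi:X\to Y$, and sending $\kappa$ to the morphism with components $o\kappa_{dX}$. Theorem. The functor $\Delta'$ is full, faithful and injective on objects, and it is left adjoint to $\Gamma'$. Thus $\Delta'$ embeds $\mathsf{ExtMnd}(\mathbf{Set}/\mathcal Q_0)$ into $\mathsf{ffYMnd}(\mathcal Q\text{-}\mathbf{Cat})$ as a full coreflective subcategory, with coreflector $\Gamma'$. -/

import Mathlib

open CategoryTheory

-- Remove a competing path from categories to quivers, so that `⟶` always elaborates through
-- `CategoryStruct.toQuiver`.
attribute [-instance] ReflQuiver.toQuiver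

universe u

/-- A quantaloid: a category whose hom-sets are complete lattices such that composition preserves
arbitrary suprema (including the empty one) in each variable. -/
class Quantaloid (Q : Type u) [SmallCategory Q] where
  homLattice : ∀ p q : Q, CompleteLattice (p ⟶ q)
  comp_sSup : ∀ {p q r : Q} (f : p ⟶ q) (S : Set (q ⟶ r)),
    f ≫ sSup S = sSup ((fun g => f ≫ g) '' S)
  sSup_comp : ∀ {p q r : Q} (S : Set (p ⟶ q)) (g : q ⟶ r),
    sSup S ≫ g = sSup ((fun f => f ≫ g) '' S)

namespace Quantaloid

noncomputable section

/-- The array (type) of an element of a set over the set of objects of `Q`. -/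
def arr {Q : Type u} (X : Over Q) (x : X.left) : Q := X.hom x

theorem arr_map {Q : Type u} {X Y : Over Q} (f : X ⟶ Y) (x : X.left) : arr Y (f.left x) = arr X x :=
  ConcreteCategory.congr_hom (Over.w f) x

variable {Q : Type u} [SmallCategory Q] [Quantaloid Q]

instance instHomLattice (p q : Q) : CompleteLattice (p ⟶ q) := homLattice p q


/-! ### Residuation -/

/-- The internal hom `γ ↙ α : q ⟶ r`, the largest `β` with `β ∘ α ≤ γ`. -/
def residual {p q r : Q} (γ : p ⟶ r) (α : p ⟶ q) : q ⟶ r := sSup {β | α ≫ β ≤ γ}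

theorem comp_iSup {p q r : Q} {ι : Sort*} (f : p ⟶ q) (g : ι → (q ⟶ r)) :
    f ≫ (⨆ i, g i) = ⨆ i, f ≫ g i := by
  rw [iSup, comp_sSup, iSup, ← Set.range_comp]; rfl

theorem iSup_comp {p q r : Q} {ι : Sort*} (f : ι → (p ⟶ q)) (g : q ⟶ r) :
    (⨆ i, f i) ≫ g = ⨆ i, f i ≫ g := by
  rw [iSup, sSup_comp, iSup, ← Set.range_comp]; rfl

theorem comp_bot {p q r : Q} (f : p ⟶ q) : f ≫ (⊥ : q ⟶ r) = ⊥ := by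
  rw [← sSup_empty, comp_sSup, Set.image_empty, sSup_empty]

theorem bot_comp {p q r : Q} (g : q ⟶ r) : (⊥ : p ⟶ q) ≫ g = ⊥ := by
  rw [← sSup_empty, sSup_comp, Set.image_empty, sSup_empty]

theorem comp_le_comp {p q r : Q} {f f' : p ⟶ q} {g g' : q ⟶ r} (hf : f ≤ f') (hg : g ≤ g') :
    f ≫ g ≤ f' ≫ g' := by
  have h1 : f ≫ g ≤ f' ≫ g := by
    rw [← sup_eq_right.2 hf, ← sSup_pair, sSup_comp]
    exact le_sSup ⟨f, by simp, rfl⟩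
  have h2 : f' ≫ g ≤ f' ≫ g' := by
    rw [← sup_eq_right.2 hg, ← sSup_pair, comp_sSup]
    exact le_sSup ⟨g, by simp, rfl⟩
  exact h1.trans h2

theorem le_residual {p q r : Q} {γ : p ⟶ r} {α : p ⟶ q} {β : q ⟶ r} :
    β ≤ residual γ α ↔ α ≫ β ≤ γ := by
  constructor
  · intro h
    refine (comp_le_comp le_rfl h).trans ?_
    rw [residual, comp_sSup]
    apply sSup_le
    rintro _ ⟨β, hβ, rfl⟩
    exact hβ
  · intro h
    exact le_sSup h

/-! ### The 2-category of `Q`-relations -/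

/-- A `Q`-relation `X ⇸ Y` between sets over `Q₀ = ob Q`, ordered pointwise. -/
abbrev QRel (X Y : Over Q) : Type u := ∀ (x : X.left) (y : Y.left), arr X x ⟶ arr Y y

namespace QRel

open Classical in
/-- The identity `Q`-relation `1°`. -/
protected def id (X : Over Q) : QRel X X := fun x y =>
  if h : x = y then eqToHom (congrArg (arr X) h) else ⊥

/-- The composite `s ∘ r` of `Q`-relations, written in diagrammatic order. -/
def comp {X Y Z : Over Q} (r : QRel X Y) (s : QRel Y Z) : QRel X Z := fun x z =>
  ⨆ y, r x y ≫ s y z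

end QRel

infixr:80 " ⨟ " => QRel.comp

/-- The graph `f_∘` of a map over `Q₀`: `f_∘ (x, y) = 1° (f x, y)`. -/
def graph {X Y : Over Q} (f : X ⟶ Y) : QRel X Y := fun x y =>
  eqToHom (arr_map f x).symm ≫ QRel.id Y (f.left x) y

/-- The cograph `f^∘` of a map over `Q₀`: `f^∘ (y, x) = 1° (y, f x)`. -/
def cograph {X Y : Over Q} (f : X ⟶ Y) : QRel Y X := fun y x =>
  QRel.id Y y (f.left x) ≫ eqToHom (arr_map f x)

section RelLemmas

variable {W X Y Z : Over Q}

theorem comp_mono {r r' : QRel X Y} {s s' : QRel Y Z} (hr : r ≤ r') (hs : s ≤ s') :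
    r ⨟ s ≤ r' ⨟ s' := fun x z =>
  iSup_mono fun y => comp_le_comp (hr x y) (hs y z)

theorem comp_assoc (r : QRel W X) (s : QRel X Y) (t : QRel Y Z) :
    (r ⨟ s) ⨟ t = r ⨟ s ⨟ t := by
  funext w z
  simp only [QRel.comp, iSup_comp, comp_iSup, Category.assoc]
  exact iSup_comm

theorem id_self (x : X.left) : QRel.id X x x = 𝟙 (arr X x) := by simp [QRel.id]

theorem id_comp (r : QRel X Y) : QRel.id X ⨟ r = r := by
  funext x y
  apply le_antisymm
  · refine iSup_le fun x' => ?_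
    by_cases h : x = x'
    · subst h; rw [id_self, Category.id_comp]
    · simp [QRel.id, h, bot_comp]
  · refine le_trans ?_ (le_iSup _ x)
    rw [id_self, Category.id_comp]

theorem comp_id (r : QRel X Y) : r ⨟ QRel.id Y = r := by
  funext x y
  apply le_antisymm
  · refine iSup_le fun x' => ?_
    by_cases h : x' = y
    · subst h; rw [id_self, Category.comp_id]
    · simp [QRel.id, h, comp_bot]
  · refine le_trans ?_ (le_iSup _ y)
    rw [id_self, Category.comp_id]

theorem graph_comp_apply (f : X ⟶ Y) (s : QRel Y Z) (x : X.left) (z : Z.left) :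
    (graph f ⨟ s) x z = eqToHom (arr_map f x).symm ≫ s (f.left x) z := by
  conv_rhs => rw [← id_comp s]
  simp only [QRel.comp, graph, comp_iSup, Category.assoc]

theorem comp_cograph_apply (f : X ⟶ Y) (s : QRel Z Y) (z : Z.left) (x : X.left) :
    (s ⨟ cograph f) z x = s z (f.left x) ≫ eqToHom (arr_map f x) := by
  conv_rhs => rw [← comp_id s]
  simp only [QRel.comp, cograph, iSup_comp, Category.assoc]

theorem graph_id : graph (𝟙 X) = QRel.id X := by
  funext x y
  exact Category.id_comp _

theorem cograph_id : cograph (𝟙 X) = QRel.id X := by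
  funext x y
  exact Category.comp_id _

theorem graph_comp (f : X ⟶ Y) (g : Y ⟶ Z) : graph (f ≫ g) = graph f ⨟ graph g := by
  funext x z
  rw [graph_comp_apply]
  simp [graph]

theorem cograph_comp (f : X ⟶ Y) (g : Y ⟶ Z) : cograph (f ≫ g) = cograph g ⨟ cograph f := by
  funext x z
  rw [comp_cograph_apply]
  simp [cograph]

theorem id_le_graph_cograph (f : X ⟶ Y) : QRel.id X ≤ graph f ⨟ cograph f := by
  intro x x'
  by_cases h : x = x'
  · subst h
    rw [comp_cograph_apply, graph, id_self, id_self]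
    simp
  · simp [QRel.id, h]

theorem cograph_graph_le (f : X ⟶ Y) : cograph f ⨟ graph f ≤ QRel.id Y := by
  intro y y'
  refine iSup_le fun x => ?_
  have : QRel.id Y y (f.left x) ≫ QRel.id Y (f.left x) y' ≤ (QRel.id Y ⨟ QRel.id Y) y y' :=
    le_iSup (fun z => QRel.id Y y z ≫ QRel.id Y z y') (f.left x)
  rw [id_comp] at this
  simpa [graph, cograph] using this

/-- Moving a graph across an inequality, on the right. -/
theorem comp_graph_le_iff (f : X ⟶ Y) (r : QRel Z X) (s : QRel Z Y) :
    r ⨟ graph f ≤ s ↔ r ≤ s ⨟ cograph f := by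
  constructor
  · intro h
    calc r = r ⨟ QRel.id X := (comp_id r).symm
      _ ≤ r ⨟ graph f ⨟ cograph f := comp_mono le_rfl (id_le_graph_cograph f)
      _ = (r ⨟ graph f) ⨟ cograph f := (comp_assoc _ _ _).symm
      _ ≤ s ⨟ cograph f := comp_mono h le_rfl
  · intro h
    calc r ⨟ graph f ≤ (s ⨟ cograph f) ⨟ graph f := comp_mono h le_rfl
      _ = s ⨟ cograph f ⨟ graph f := comp_assoc _ _ _
      _ ≤ s ⨟ QRel.id Y := comp_mono le_rfl (cograph_graph_le f)
      _ = s := comp_id s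

/-- Moving a cograph across an inequality, on the left. -/
theorem cograph_comp_le_iff (f : X ⟶ Y) (r : QRel X Z) (s : QRel Y Z) :
    cograph f ⨟ r ≤ s ↔ r ≤ graph f ⨟ s := by
  constructor
  · intro h
    calc r = QRel.id X ⨟ r := (id_comp r).symm
      _ ≤ (graph f ⨟ cograph f) ⨟ r := comp_mono (id_le_graph_cograph f) le_rfl
      _ = graph f ⨟ cograph f ⨟ r := comp_assoc _ _ _
      _ ≤ graph f ⨟ s := comp_mono le_rfl h
  · intro h
    calc cograph f ⨟ r ≤ cograph f ⨟ graph f ⨟ s := comp_mono le_rfl h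
      _ = (cograph f ⨟ graph f) ⨟ s := (comp_assoc _ _ _).symm
      _ ≤ QRel.id Y ⨟ s := comp_mono (cograph_graph_le f) le_rfl
      _ = s := id_comp s

end RelLemmas

/-- `g^∘ ∘ r ∘ f_∘`, the `Q`-relation `(w, z) ↦ r (f w, g z)`. -/
def restrict {W X Y Z : Over Q} (f : W ⟶ X) (r : QRel X Y) (g : Z ⟶ Y) : QRel W Z :=
  graph f ⨟ r ⨟ cograph g

section RestrictLemmas

variable {V W X Y Z V' W' X' Y' Z' : Over Q}

theorem restrict_apply (f : W ⟶ X) (r : QRel X Y) (g : Z ⟶ Y) (w : W.left) (z : Z.left) :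
    restrict f r g w z =
      eqToHom (arr_map f w).symm ≫ r (f.left w) (g.left z) ≫ eqToHom (arr_map g z) := by
  rw [restrict, graph_comp_apply, comp_cograph_apply]

theorem restrict_mono (f : W ⟶ X) {r r' : QRel X Y} (h : r ≤ r') (g : Z ⟶ Y) :
    restrict f r g ≤ restrict f r' g :=
  comp_mono le_rfl (comp_mono h le_rfl)

theorem restrict_restrict (f : W ⟶ X) (f' : X ⟶ X') (r : QRel X' Y') (g' : Y ⟶ Y') (g : Z ⟶ Y) :
    restrict f (restrict f' r g') g = restrict (f ≫ f') r (g ≫ g') := by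
  simp only [restrict, graph_comp, cograph_comp, comp_assoc]

theorem restrict_id (r : QRel X Y) : restrict (𝟙 X) r (𝟙 Y) = r := by
  rw [restrict, graph_id, cograph_id, comp_id, id_comp]

theorem restrict_id_right (f : W ⟶ X) (r : QRel X Y) : restrict f r (𝟙 Y) = graph f ⨟ r := by
  rw [restrict, cograph_id, comp_id]

theorem restrict_id_left (r : QRel X Y) (g : Z ⟶ Y) : restrict (𝟙 X) r g = r ⨟ cograph g := by
  rw [restrict, graph_id, id_comp]

theorem restrict_comp_restrict_le (f : V ⟶ W) (r : QRel W X) (g : V' ⟶ X) (s : QRel X Y)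
    (h : Z ⟶ Y) : restrict f r g ⨟ restrict g s h ≤ restrict f (r ⨟ s) h := by
  have : (cograph g ⨟ graph g) ⨟ s ⨟ cograph h ≤ s ⨟ cograph h := by
    calc _ ≤ QRel.id _ ⨟ s ⨟ cograph h := comp_mono (cograph_graph_le g) le_rfl
      _ = _ := id_comp _
  rw [comp_assoc] at this
  simp only [restrict, comp_assoc]
  exact comp_mono le_rfl (comp_mono le_rfl this)

theorem id_le_restrict (f : X ⟶ Y) : QRel.id X ≤ restrict f (QRel.id Y) f := by
  rw [restrict, id_comp]; exact id_le_graph_cograph f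

theorem comp_graph_le_graph_comp_iff {f : X ⟶ X'} {g : Y ⟶ Y'} {r : QRel X Y} {s : QRel X' Y'} :
    r ⨟ graph g ≤ graph f ⨟ s ↔ r ≤ restrict f s g := by
  rw [comp_graph_le_iff, comp_assoc, restrict]

theorem cograph_comp_le_comp_cograph_iff {f : X ⟶ X'} {g : Y ⟶ Y'} {r : QRel X Y}
    {s : QRel X' Y'} : cograph f ⨟ r ≤ s ⨟ cograph g ↔ r ≤ restrict f s g := by
  rw [cograph_comp_le_iff, restrict]

end RestrictLemmas

/-! ### `Q`-categories and `Q`-functors -/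

variable (Q) in
/-- A (small) `Q`-category: a set over `Q₀` with a `Q`-relation `a` satisfying
`1° ≤ a` and `a ∘ a ≤ a`. -/
structure QCat where
  base : Over Q
  hom : QRel base base
  id_le : QRel.id base ≤ hom
  comp_le : hom ⨟ hom ≤ hom

namespace QCat

theorem comp_self (X : QCat Q) : X.hom ⨟ X.hom = X.hom :=
  le_antisymm X.comp_le <| by
    calc X.hom = QRel.id _ ⨟ X.hom := (id_comp _).symm
      _ ≤ X.hom ⨟ X.hom := comp_mono X.id_le le_rfl

/-- A `Q`-functor `(X, a) → (Y, b)`: a map over `Q₀` with `a ≤ f^∘ ∘ b ∘ f_∘`, that is,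
`a (x, x') ≤ b (f x, f x')`. -/
@[ext]
structure Hom (X Y : QCat Q) where
  base : X.base ⟶ Y.base
  map_le : X.hom ≤ restrict base Y.hom base

instance : Category (QCat Q) where
  Hom := Hom
  id X := ⟨𝟙 X.base, (restrict_id X.hom).ge⟩
  comp f g := ⟨f.base ≫ g.base, by
    rw [← restrict_restrict]; exact f.map_le.trans (restrict_mono _ g.map_le _)⟩
  id_comp f := Hom.ext (Category.id_comp f.base)
  comp_id f := Hom.ext (Category.comp_id f.base)
  assoc f g h := Hom.ext (Category.assoc f.base g.base h.base)

@[ext]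
theorem hom_ext {X Y : QCat Q} {f g : X ⟶ Y} (h : f.base = g.base) : f = g := Hom.ext h

@[simp] theorem id_base (X : QCat Q) : Hom.base (𝟙 X) = 𝟙 X.base := rfl

@[simp] theorem comp_base {X Y Z : QCat Q} (f : X ⟶ Y) (g : Y ⟶ Z) :
    (f ≫ g).base = f.base ≫ g.base := rfl

/-- The underlying order of a `Q`-category: `x ≤ x'` iff `|x| = |x'|` and `1_{|x|} ≤ a (x, x')`. -/
def Le (X : QCat Q) (x x' : X.base.left) : Prop :=
  ∃ h : arr X.base x = arr X.base x', eqToHom h ≤ X.hom x x'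

/-- The pointwise order of `Q`-functors, providing the 2-cells of `Q`-Cat. -/
instance (X Y : QCat Q) : LE (X ⟶ Y) where
  le f g := ∀ x, Y.Le (f.base.left x) (g.base.left x)

theorem le_iff {X Y : QCat Q} (f g : X ⟶ Y) :
    f ≤ g ↔ QRel.id X.base ≤ restrict f.base Y.hom g.base := by
  have aux : ∀ {p q r : Q} (hp : p = r) (hq : q = r) (k : p ⟶ q),
      (∃ h : p = q, eqToHom h ≤ k) ↔ 𝟙 r ≤ eqToHom hp.symm ≫ k ≫ eqToHom hq := by
    intro p q r hp hq k
    subst hp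
    subst hq
    simp
  have key : ∀ x, Y.Le (f.base.left x) (g.base.left x) ↔
      𝟙 _ ≤ restrict f.base Y.hom g.base x x := by
    intro x
    rw [restrict_apply]
    exact aux (arr_map f.base x) (arr_map g.base x) _
  constructor
  · intro h x x'
    by_cases hx : x = x'
    · subst hx
      rw [id_self]
      exact (key x).1 (h x)
    · simp [QRel.id, hx]
  · intro h x
    refine (key x).2 ?_
    have := h x x
    rwa [id_self] at this

theorem comp_cograph_le_of_le {X Y : QCat Q} {f g : X ⟶ Y} (h : f ≤ g) :
    Y.hom ⨟ cograph f.base ≤ Y.hom ⨟ cograph g.base := by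
  rw [le_iff, restrict, ← cograph_comp_le_iff, comp_id] at h
  calc Y.hom ⨟ cograph f.base ≤ Y.hom ⨟ Y.hom ⨟ cograph g.base := comp_mono le_rfl h
    _ = (Y.hom ⨟ Y.hom) ⨟ cograph g.base := (comp_assoc _ _ _).symm
    _ = _ := by rw [comp_self]

theorem graph_comp_le_of_le {X Y : QCat Q} {f g : X ⟶ Y} (h : f ≤ g) :
    graph g.base ⨟ Y.hom ≤ graph f.base ⨟ Y.hom := by
  rw [le_iff, restrict, ← comp_assoc, ← comp_graph_le_iff, id_comp] at h
  calc graph g.base ⨟ Y.hom ≤ (graph f.base ⨟ Y.hom) ⨟ Y.hom := comp_mono h le_rfl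
    _ = _ := by rw [comp_assoc, comp_self]

instance (X Y : QCat Q) : Preorder (X ⟶ Y) where
  le_refl f x := ⟨rfl, by
    have := Y.id_le (f.base.left x) (f.base.left x)
    rwa [id_self] at this⟩
  le_trans f g h hfg hgh := by
    rw [le_iff] at hfg ⊢
    exact hfg.trans (comp_mono le_rfl (comp_cograph_le_of_le hgh))

/-- A `Q`-functor is fully faithful if `a = f^∘ ∘ b ∘ f_∘`, that is, `a (x, x') = b (f x, f x')`. -/
def FullyFaithful {X Y : QCat Q} (f : X ⟶ Y) : Prop :=
  X.hom = restrict f.base Y.hom f.base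

end QCat

/-! ### Distributors -/

/-- A `Q`-distributor `(X, a) ⇸ (Y, b)`: a `Q`-relation `φ` with `b ∘ φ ∘ a ≤ φ`. -/
@[ext]
structure Dist (X Y : QCat Q) where
  rel : QRel X.base Y.base
  compat : X.hom ⨟ rel ⨟ Y.hom ≤ rel

namespace Dist

variable {W X Y Z : QCat Q}

theorem hom_comp_rel (φ : Dist X Y) : X.hom ⨟ φ.rel = φ.rel := by
  apply le_antisymm
  · calc X.hom ⨟ φ.rel = X.hom ⨟ φ.rel ⨟ QRel.id _ := by rw [comp_id]
      _ ≤ X.hom ⨟ φ.rel ⨟ Y.hom := comp_mono le_rfl (comp_mono le_rfl Y.id_le)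
      _ ≤ φ.rel := φ.compat
  · calc φ.rel = QRel.id _ ⨟ φ.rel := (id_comp _).symm
      _ ≤ X.hom ⨟ φ.rel := comp_mono X.id_le le_rfl

theorem rel_comp_hom (φ : Dist X Y) : φ.rel ⨟ Y.hom = φ.rel := by
  apply le_antisymm
  · calc φ.rel ⨟ Y.hom = QRel.id _ ⨟ φ.rel ⨟ Y.hom := by rw [id_comp]
      _ ≤ X.hom ⨟ φ.rel ⨟ Y.hom := comp_mono X.id_le le_rfl
      _ ≤ φ.rel := φ.compat
  · calc φ.rel = φ.rel ⨟ QRel.id _ := (comp_id _).symm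
      _ ≤ φ.rel ⨟ Y.hom := comp_mono le_rfl Y.id_le

/-- The identity distributor `1^*_X = a`. -/
protected def id (X : QCat Q) : Dist X X := ⟨X.hom, by rw [X.comp_self, X.comp_self]⟩

/-- Composition of distributors (in diagrammatic order). -/
def comp (φ : Dist X Y) (ψ : Dist Y Z) : Dist X Z :=
  ⟨φ.rel ⨟ ψ.rel, by rw [comp_assoc, rel_comp_hom, ← comp_assoc, hom_comp_rel]⟩

/-- The distributor `f_* = b ∘ f_∘` of a `Q`-functor. -/
def lower (f : X ⟶ Y) : Dist X Y :=
  ⟨graph f.base ⨟ Y.hom, by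
    rw [comp_assoc, Y.comp_self]
    have h := comp_graph_le_graph_comp_iff.2 f.map_le
    calc X.hom ⨟ graph f.base ⨟ Y.hom = (X.hom ⨟ graph f.base) ⨟ Y.hom := (comp_assoc _ _ _).symm
      _ ≤ (graph f.base ⨟ Y.hom) ⨟ Y.hom := comp_mono h le_rfl
      _ = graph f.base ⨟ Y.hom := by rw [comp_assoc, Y.comp_self]
      _ ≤ _ := le_rfl⟩

/-- The distributor `f^* = f^∘ ∘ b` of a `Q`-functor. -/
def upper (f : X ⟶ Y) : Dist Y X :=
  ⟨Y.hom ⨟ cograph f.base, by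
    have h := cograph_comp_le_comp_cograph_iff.2 f.map_le
    calc Y.hom ⨟ (Y.hom ⨟ cograph f.base) ⨟ X.hom
        = Y.hom ⨟ cograph f.base ⨟ X.hom := by rw [← comp_assoc, ← comp_assoc, Y.comp_self,
            comp_assoc]
      _ ≤ Y.hom ⨟ Y.hom ⨟ cograph f.base := comp_mono le_rfl h
      _ = Y.hom ⨟ cograph f.base := by rw [← comp_assoc, Y.comp_self]⟩

end Dist

/-! ### The discretization adjunction `d ⊣ o` -/

variable (Q) in
/-- The set-of-objects functor `o : Q-Cat ⥤ Set/Q₀`. -/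
def oFunctor : QCat Q ⥤ Over Q where
  obj X := X.base
  map f := f.base

variable (Q) in
/-- The discrete functor `d : Set/Q₀ ⥤ Q-Cat`, `X ↦ (X, 1°)`. -/
def dFunctor : Over Q ⥤ QCat Q where
  obj X := ⟨X, QRel.id X, le_rfl, (id_comp _).le⟩
  map f := ⟨f, id_le_restrict f⟩

/-- The counit `ε : d o ⟶ 1` of `d ⊣ o`, whose components are carried by identity maps. -/
def counit (X : QCat Q) : (dFunctor Q).obj X.base ⟶ X :=
  ⟨𝟙 X.base, X.id_le.trans (restrict_id X.hom).ge⟩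

theorem counit_naturality {X Y : QCat Q} (f : X ⟶ Y) :
    (dFunctor Q).map f.base ≫ counit Y = counit X ≫ f := by
  ext1
  exact (Category.comp_id _).trans (Category.id_comp _).symm

theorem counit_d (X : Over Q) : counit ((dFunctor Q).obj X) = 𝟙 _ := rfl

/-- The action of `d` on `Q`-relations, `Q-Rel → Q-Dist`. -/
def dRel {X Y : Over Q} (r : QRel X Y) : Dist ((dFunctor Q).obj X) ((dFunctor Q).obj Y) :=
  ⟨r, by
    change QRel.id X ⨟ r ⨟ QRel.id Y ≤ r
    rw [comp_id, id_comp]⟩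

/-! ### Presheaves -/

/-- The singleton `Q`-category `{s}` with one object of array `s` and hom `1_s`. -/
def singleton (s : Q) : QCat Q :=
  (dFunctor Q).obj (Over.mk (Y := PUnit.{u + 1}) (↾fun _ => s))

/-- The set over `Q₀` of presheaves on `X`, that is, of distributors `σ : X ⇸ {s}`, with
`|σ| = s`. -/
def presheafBase (X : QCat Q) : Over Q :=
  Over.mk (Y := Σ s : Q, Dist X (singleton s)) (↾fun σ => σ.1)

/-- The value `σ_x : |x| ⟶ |σ|` of a presheaf. -/
def presheafVal {X : QCat Q} (σ : (presheafBase X).left) (x : X.base.left) :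
    arr X.base x ⟶ arr (presheafBase X) σ :=
  Dist.rel (Sigma.snd σ) x PUnit.unit

/-- The hom of presheaves, `τ ↙ σ = ⋀ₓ τ_x ↙ σ_x`. -/
def presheafHom (X : QCat Q) : QRel (presheafBase X) (presheafBase X) := fun σ τ =>
  ⨅ x, residual (presheafVal τ x) (presheafVal σ x)

theorem le_presheafHom {X : QCat Q} {σ τ : (presheafBase X).left}
    {α : arr (presheafBase X) σ ⟶ arr (presheafBase X) τ} :
    α ≤ presheafHom X σ τ ↔ ∀ x, presheafVal σ x ≫ α ≤ presheafVal τ x := by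
  simp only [presheafHom, le_iInf_iff, le_residual]

/-- The presheaf `Q`-category `P X`. -/
def presheaf (X : QCat Q) : QCat Q where
  base := presheafBase X
  hom := presheafHom X
  id_le σ τ := by
    by_cases h : σ = τ
    · subst h
      rw [id_self, le_presheafHom]
      intro x
      rw [Category.comp_id]
    · simp [QRel.id, h]
  comp_le σ τ := by
    refine iSup_le fun ρ => ?_
    rw [le_presheafHom]
    intro x
    rw [← Category.assoc]
    exact (comp_le_comp (le_presheafHom.1 le_rfl x) le_rfl).trans (le_presheafHom.1 le_rfl x)

theorem presheafVal_compat {X : QCat Q} (σ : (presheafBase X).left) (x x' : X.base.left) :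
    X.hom x x' ≫ presheafVal σ x' ≤ presheafVal σ x := by
  have h := congrFun (congrFun (Dist.hom_comp_rel (Sigma.snd σ)) x) PUnit.unit
  exact (le_iSup (fun y => X.hom x y ≫ presheafVal σ y) x').trans h.le

/-- The presheaf with given array and values. -/
def mkPresheaf {X : QCat Q} (s : Q) (v : ∀ x : X.base.left, arr X.base x ⟶ s)
    (hv : ∀ x x', X.hom x x' ≫ v x' ≤ v x) : (presheafBase X).left :=
  ⟨s, ⟨fun x _ => v x, by
    change X.hom ⨟ (fun x _ => v x : QRel X.base (singleton s).base) ⨟ QRel.id _ ≤ _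
    refine (comp_mono le_rfl (comp_id _).le).trans ?_
    exact fun x _ => iSup_le fun x' => hv x x'⟩⟩

/-- The presheaf `φ (-, y)`. -/
def transposeFun {X Y : QCat Q} (φ : Dist X Y) (y : Y.base.left) : (presheafBase X).left :=
  mkPresheaf (arr Y.base y) (fun x => φ.rel x y) fun x x' => by
    have h := congrFun (congrFun φ.hom_comp_rel x) y
    exact (le_iSup (fun x' => X.hom x x' ≫ φ.rel x' y) x').trans h.le

/-- The transpose `←φ : Y → P X` of a distributor `φ : X ⇸ Y`, with `(←φ y)_x = φ (x, y)`. -/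
def transpose {X Y : QCat Q} (φ : Dist X Y) : Y ⟶ presheaf X where
  base := Over.homMk (↾transposeFun φ) rfl
  map_le y y' := by
    rw [restrict_apply]
    refine le_of_le_of_eq (b := presheafHom X (transposeFun φ y) (transposeFun φ y'))
      (le_presheafHom.2 fun x => ?_) ((Category.id_comp _).trans (Category.comp_id _)).symm
    have h := congrFun (congrFun φ.rel_comp_hom x) y'
    exact (le_iSup (fun y => φ.rel x y ≫ Y.hom y y') y).trans h.le

/-- The Yoneda `Q`-functor `y_X : X → P X`, the transpose of the identity distributor. -/
def yoneda (X : QCat Q) : X ⟶ presheaf X := transpose (Dist.id X)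

/-- The Yoneda lemma: `1_{P X} (y_X x, ←φ y) = φ (x, y)`. -/
theorem yoneda_restrict {X Y : QCat Q} (φ : Dist X Y) :
    restrict (yoneda X).base (presheaf X).hom (transpose φ).base = φ.rel := by
  funext x y
  rw [restrict_apply]
  refine Eq.trans (b := presheafHom X ((yoneda X).base.left x) ((transpose φ).base.left y))
    ((Category.id_comp _).trans (Category.comp_id _)) ?_
  apply le_antisymm
  · have h : X.hom x x ≫ presheafHom X ((yoneda X).base.left x) ((transpose φ).base.left y) ≤
      φ.rel x y := (le_presheafHom (X := X) (σ := (yoneda X).base.left x)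
        (τ := (transpose φ).base.left y)).1 le_rfl x
    have h1 := X.id_le x x
    rw [id_self] at h1
    refine le_trans ?_ h
    refine le_trans ?_ (comp_le_comp h1 le_rfl)
    exact (Category.id_comp _).ge
  · refine (le_presheafHom (X := X) (σ := (yoneda X).base.left x)
        (τ := (transpose φ).base.left y)).2 fun x' => ?_
    have h := congrFun (congrFun φ.hom_comp_rel x') y
    exact (le_iSup (fun x => X.hom x' x ≫ φ.rel x y) x).trans h.le

/-- The `Q`-functor `φ^⊙ : P Y → P X`, `τ ↦ τ ∘ φ`. -/
def pullPresheaf {X Y : QCat Q} (φ : Dist X Y) : presheaf Y ⟶ presheaf X where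
  base := Over.homMk (↾fun (τ : (presheafBase Y).left) =>
    (⟨Sigma.fst τ, φ.comp (Sigma.snd τ)⟩ : (presheafBase X).left)) rfl
  map_le σ τ := by
    rw [restrict_apply]
    refine le_of_le_of_eq (b := presheafHom X ⟨Sigma.fst σ, φ.comp (Sigma.snd σ)⟩
      ⟨Sigma.fst τ, φ.comp (Sigma.snd τ)⟩) (le_presheafHom.2 fun x => ?_)
      ((Category.id_comp _).trans (Category.comp_id _)).symm
    change (⨆ y, φ.rel x y ≫ presheafVal σ y) ≫ presheafHom Y σ τ ≤
      ⨆ y, φ.rel x y ≫ presheafVal τ y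
    rw [iSup_comp]
    refine iSup_mono fun y => ?_
    rw [Category.assoc]
    exact comp_le_comp le_rfl (le_presheafHom.1 le_rfl y)

/-! ### Lax extensions to `Q`-Rel -/

/-- A lax extension `T̂` of a functor `T` on `Set/Q₀` to `Q`-Rel: a lax 2-functor on `Q`-Rel that
agrees with `T` on objects and satisfies `(T f)_∘ ≤ T̂ (f_∘)` and `(T f)^∘ ≤ T̂ (f^∘)`. -/
@[ext]
structure LaxExt (T : Over Q ⥤ Over Q) where
  map : ∀ {X Y : Over Q}, QRel X Y → QRel (T.obj X) (T.obj Y)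
  map_mono : ∀ {X Y : Over Q} {r s : QRel X Y}, r ≤ s → map r ≤ map s
  id_le_map_id : ∀ X : Over Q, QRel.id (T.obj X) ≤ map (QRel.id X)
  map_comp_map_le : ∀ {X Y Z : Over Q} (r : QRel X Y) (s : QRel Y Z),
    map r ⨟ map s ≤ map (r ⨟ s)
  graph_le : ∀ {X Y : Over Q} (f : X ⟶ Y), graph (T.map f) ≤ map (graph f)
  cograph_le : ∀ {X Y : Over Q} (f : X ⟶ Y), cograph (T.map f) ≤ map (cograph f)

namespace LaxExt

variable {T : Over Q ⥤ Over Q} (E : LaxExt T) {W X Y Z : Over Q}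

theorem map_graph_comp (f : X ⟶ Y) (r : QRel Y Z) :
    E.map (graph f ⨟ r) = graph (T.map f) ⨟ E.map r := by
  apply le_antisymm
  · rw [← cograph_comp_le_iff]
    calc cograph (T.map f) ⨟ E.map (graph f ⨟ r)
        ≤ E.map (cograph f) ⨟ E.map (graph f ⨟ r) := comp_mono (E.cograph_le f) le_rfl
      _ ≤ E.map (cograph f ⨟ graph f ⨟ r) := E.map_comp_map_le _ _
      _ ≤ E.map r := E.map_mono ((cograph_comp_le_iff _ _ _).2 le_rfl)
  · exact (comp_mono (E.graph_le f) le_rfl).trans (E.map_comp_map_le _ _)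

theorem map_comp_cograph (r : QRel X Y) (f : Z ⟶ Y) :
    E.map (r ⨟ cograph f) = E.map r ⨟ cograph (T.map f) := by
  apply le_antisymm
  · rw [← comp_graph_le_iff]
    calc E.map (r ⨟ cograph f) ⨟ graph (T.map f)
        ≤ E.map (r ⨟ cograph f) ⨟ E.map (graph f) := comp_mono le_rfl (E.graph_le f)
      _ ≤ E.map ((r ⨟ cograph f) ⨟ graph f) := E.map_comp_map_le _ _
      _ ≤ E.map r := E.map_mono ((comp_graph_le_iff _ _ _).2 le_rfl)
  · exact (comp_mono le_rfl (E.cograph_le f)).trans (E.map_comp_map_le _ _)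

theorem map_restrict (f : W ⟶ X) (r : QRel X Y) (g : Z ⟶ Y) :
    E.map (restrict f r g) = restrict (T.map f) (E.map r) (T.map g) := by
  rw [restrict, map_graph_comp, map_comp_cograph, restrict]

end LaxExt

/-- `T̂` is a lax extension of the monad `(T, m, e)`: the transformations `m_∘ : T̂ T̂ → T̂` and
`e_∘ : 1 → T̂` are oplax. -/
structure LaxExt.IsMonadExt {T : Monad (Over Q)} (E : LaxExt T.toFunctor) : Prop where
  mu : ∀ {X Y : Over Q} (r : QRel X Y),
    E.map (E.map r) ⨟ graph (T.μ.app Y) ≤ graph (T.μ.app X) ⨟ E.map r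
  eta : ∀ {X Y : Over Q} (r : QRel X Y),
    r ⨟ graph (T.η.app Y) ≤ graph (T.η.app X) ⨟ E.map r

variable (Q) in
/-- Objects of `ExtMnd(Set/Q₀)`: monads on `Set/Q₀` with a lax extension to `Q`-Rel. -/
structure ExtMnd where
  monad : Monad (Over Q)
  ext : LaxExt monad.toFunctor
  isMonadExt : ext.IsMonadExt

namespace ExtMnd

/-- A morphism of lax extensions: a monad morphism `λ` such that `λ_∘ : Ŝ → T̂` is oplax. -/
@[ext]
structure Hom (E F : ExtMnd Q) where
  hom : E.monad ⟶ F.monad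
  oplax : ∀ {X Y : Over Q} (r : QRel X Y),
    E.ext.map r ⨟ graph (hom.app Y) ≤ graph (hom.app X) ⨟ F.ext.map r

instance : Category (ExtMnd Q) where
  Hom := Hom
  id E := ⟨𝟙 E.monad, fun r => by
    change E.ext.map r ⨟ graph (𝟙 _) ≤ graph (𝟙 _) ⨟ E.ext.map r
    rw [graph_id, graph_id, comp_id, id_comp]⟩
  comp {E F G} f g := ⟨f.hom ≫ g.hom, fun {X Y} r => by
    change E.ext.map r ⨟ graph (f.hom.app Y ≫ g.hom.app Y) ≤
      graph (f.hom.app X ≫ g.hom.app X) ⨟ G.ext.map r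
    rw [comp_graph_le_graph_comp_iff, ← restrict_restrict]
    exact (comp_graph_le_graph_comp_iff.1 (f.oplax r)).trans
      (restrict_mono _ (comp_graph_le_graph_comp_iff.1 (g.oplax r)) _)⟩
  id_comp f := Hom.ext (Category.id_comp f.hom)
  comp_id f := Hom.ext (Category.comp_id f.hom)
  assoc f g h := Hom.ext (Category.assoc f.hom g.hom h.hom)

@[ext]
theorem hom_ext {E F : ExtMnd Q} {f g : E ⟶ F} (h : f.hom = g.hom) : f = g := Hom.ext h

end ExtMnd

/-! ### 2-monads on `Q`-Cat -/

/-- A functor on `Q`-Cat is a 2-functor if it preserves the order of `Q`-functors. -/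
def IsTwoFunctor (T : QCat Q ⥤ QCat Q) : Prop :=
  ∀ ⦃X Y : QCat Q⦄ (f g : X ⟶ Y), f ≤ g → T.map f ≤ T.map g

/-- A functor on `Q`-Cat preserves the full fidelity of all Yoneda `Q`-functors. -/
def PreservesYonedaFF (T : QCat Q ⥤ QCat Q) : Prop :=
  ∀ X : QCat Q, QCat.FullyFaithful (T.map (yoneda X))

variable (Q) in
/-- The property of monads on `Q`-Cat defining `ffYMnd(Q-Cat)`: being a 2-monad (a monad whose
endofunctor is a 2-functor; since the 2-cells of `Q`-Cat form preorders, this is the only extra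
condition) whose endofunctor preserves the full fidelity of all Yoneda `Q`-functors. -/
def ffYProperty : ObjectProperty (Monad (QCat Q)) := fun T =>
  IsTwoFunctor T.toFunctor ∧ PreservesYonedaFF T.toFunctor

variable (Q) in
/-- The full subcategory `ffYMnd(Q-Cat)` of the category of monads on `Q`-Cat. -/
abbrev FFYMnd := (ffYProperty Q).FullSubcategory

/-! ### The functor `Δ'` -/

namespace Delta

/-- The functor `(X, a) ↦ (T X, T̂ a)` on `Q`-Cat. -/
def functor (E : ExtMnd Q) : QCat Q ⥤ QCat Q where
  obj X :=
    { base := E.monad.obj X.base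
      hom := E.ext.map X.hom
      id_le := (E.ext.id_le_map_id _).trans (E.ext.map_mono X.id_le)
      comp_le := (E.ext.map_comp_map_le _ _).trans (E.ext.map_mono X.comp_le) }
  map f := ⟨E.monad.map f.base, by
    rw [← E.ext.map_restrict]; exact E.ext.map_mono f.map_le⟩
  map_id X := QCat.hom_ext (E.monad.map_id X.base)
  map_comp f g := QCat.hom_ext (E.monad.map_comp f.base g.base)

/-- The monad `(𝒯, 𝗆, 𝖾)` on `Q`-Cat that lifts `(T, m, e)` along `o`. -/
def monad (E : ExtMnd Q) : Monad (QCat Q) where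
  toFunctor := functor E
  η :=
    { app := fun X => ⟨E.monad.η.app X.base,
        comp_graph_le_graph_comp_iff.1 (E.isMonadExt.eta X.hom)⟩
      naturality := fun _ _ f => QCat.hom_ext (E.monad.η.naturality f.base) }
  μ :=
    { app := fun X => ⟨E.monad.μ.app X.base,
        comp_graph_le_graph_comp_iff.1 (E.isMonadExt.mu X.hom)⟩
      naturality := fun _ _ f => QCat.hom_ext (E.monad.μ.naturality f.base) }
  assoc X := QCat.hom_ext (E.monad.assoc X.base)
  left_unit X := QCat.hom_ext (E.monad.left_unit X.base)
  right_unit X := QCat.hom_ext (E.monad.right_unit X.base)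

theorem property (E : ExtMnd Q) : ffYProperty Q (monad E) := by
  constructor
  · intro X Y f g h
    rw [QCat.le_iff] at h ⊢
    have := E.ext.map_mono h
    rw [E.ext.map_restrict] at this
    exact (E.ext.id_le_map_id _).trans this
  · intro X
    have h := congrArg E.ext.map (yoneda_restrict (Dist.id X))
    rw [E.ext.map_restrict] at h
    exact h.symm

/-- The monad morphism on `Q`-Cat with the same underlying maps as `λ`. -/
def monadHom {E F : ExtMnd Q} (f : E ⟶ F) : monad E ⟶ monad F where
  app X := ⟨f.hom.app X.base, comp_graph_le_graph_comp_iff.1 (f.oplax X.hom)⟩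
  naturality _ _ g := QCat.hom_ext (f.hom.naturality g.base)
  app_η X := QCat.hom_ext (f.hom.app_η X.base)
  app_μ X := QCat.hom_ext (f.hom.app_μ X.base)

end Delta

variable (Q) in
/-- The functor `Δ' : ExtMnd(Set/Q₀) ⥤ ffYMnd(Q-Cat)`. -/
def DeltaFunctor : ExtMnd Q ⥤ FFYMnd Q where
  obj E := ⟨Delta.monad E, Delta.property E⟩
  map f := ObjectProperty.homMk (Delta.monadHom f)
  map_id _ := rfl
  map_comp _ _ := rfl

/-! ### The minimal lax extension of a 2-functor on `Q`-Cat -/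

/-- `𝒯̄ φ = (𝒯 ←φ)^* ∘ (𝒯 y_X)_*`. -/
def barExt (T : QCat Q ⥤ QCat Q) {X Y : QCat Q} (φ : Dist X Y) : Dist (T.obj X) (T.obj Y) :=
  (Dist.lower (T.map (yoneda X))).comp (Dist.upper (T.map (transpose φ)))

namespace barExt

variable {T : QCat Q ⥤ QCat Q} {W X Y Z : QCat Q}

theorem rel_eq (φ : Dist X Y) : (barExt T φ).rel =
    restrict (T.map (yoneda X)).base (T.obj (presheaf X)).hom (T.map (transpose φ)).base := by
  change (graph _ ⨟ QCat.hom _) ⨟ QCat.hom _ ⨟ cograph _ = _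
  rw [comp_assoc, ← comp_assoc (QCat.hom _), QCat.comp_self, restrict]

theorem transpose_le_transpose {φ ψ : Dist X Y} (h : φ.rel ≤ ψ.rel) :
    transpose φ ≤ transpose ψ := fun y => ⟨rfl, (le_presheafHom (X := X)
      (σ := transposeFun φ y) (τ := transposeFun ψ y)).2 fun x =>
        (Category.comp_id _).le.trans (h x y)⟩

theorem transpose_comp (φ : Dist X Y) (ψ : Dist Y Z) :
    transpose (φ.comp ψ) = transpose ψ ≫ pullPresheaf φ := rfl

theorem yoneda_comp_pullPresheaf (φ : Dist X Y) :
    yoneda Y ≫ pullPresheaf φ = transpose φ := by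
  have h : φ.comp (Dist.id Y) = φ := Dist.ext φ.rel_comp_hom
  rw [yoneda, ← transpose_comp, h]

/-- The restriction `g^* ∘ φ ∘ f_*` of a distributor along `Q`-functors. -/
def restrictDist (f : W ⟶ X) (φ : Dist X Y) (g : Z ⟶ Y) : Dist W Z where
  rel := restrict f.base φ.rel g.base
  compat := by
    calc _ ≤ restrict f.base X.hom f.base ⨟ restrict f.base φ.rel g.base ⨟
          restrict g.base Y.hom g.base :=
            comp_mono f.map_le (comp_mono le_rfl g.map_le)
      _ ≤ restrict f.base X.hom f.base ⨟ restrict f.base (φ.rel ⨟ Y.hom) g.base :=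
            comp_mono le_rfl (restrict_comp_restrict_le _ _ _ _ _)
      _ ≤ restrict f.base (X.hom ⨟ φ.rel ⨟ Y.hom) g.base := restrict_comp_restrict_le _ _ _ _ _
      _ ≤ _ := restrict_mono _ φ.compat _

theorem transpose_restrictDist_right (φ : Dist X Y) (g : Z ⟶ Y) :
    transpose (restrictDist (𝟙 X) φ g) = g ≫ transpose φ := by
  have h : ∀ {s t : Q} (hst : s = t) (v : ∀ x : X.base.left, arr X.base x ⟶ s)
      (w : ∀ x : X.base.left, arr X.base x ⟶ t) (hv) (hw),
      (∀ x, v x = w x ≫ eqToHom hst.symm) →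
      (mkPresheaf s v hv : (presheafBase X).left) = mkPresheaf t w hw := by
    intro s t hst v w hv hw hvw
    subst hst
    have : v = w := funext fun x => by simpa using hvw x
    subst this
    rfl
  apply QCat.hom_ext
  apply Over.OverMorphism.ext
  apply ConcreteCategory.hom_ext
  intro z
  refine h (arr_map g.base z).symm (fun x => restrict (𝟙 X.base) φ.rel g.base x z)
    (fun x => φ.rel x (g.base.left z))
    (fun x x' => presheafVal_compat (transposeFun (restrictDist (𝟙 X) φ g) z) x x')
    (fun x x' => presheafVal_compat (transposeFun φ (g.base.left z)) x x') fun x => ?_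
  rw [restrict_id_left, comp_cograph_apply]

theorem mono (hT : IsTwoFunctor T) {φ ψ : Dist X Y} (h : φ.rel ≤ ψ.rel) :
    (barExt T φ).rel ≤ (barExt T ψ).rel := by
  rw [rel_eq, rel_eq]
  exact comp_mono le_rfl (QCat.comp_cograph_le_of_le (hT _ _ (transpose_le_transpose h)))

theorem comp_le (φ : Dist X Y) (ψ : Dist Y Z) :
    (barExt T φ).rel ⨟ (barExt T ψ).rel ≤ (barExt T (φ.comp ψ)).rel := by
  have h := restrict_mono (T.map (yoneda Y)).base (T.map (pullPresheaf φ)).map_le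
    (T.map (transpose ψ)).base
  rw [restrict_restrict, ← QCat.comp_base, ← QCat.comp_base, ← T.map_comp, ← T.map_comp,
    yoneda_comp_pullPresheaf, ← transpose_comp] at h
  rw [rel_eq, rel_eq, rel_eq]
  refine (comp_mono le_rfl h).trans ((restrict_comp_restrict_le _ _ _ _ _).trans ?_)
  rw [QCat.comp_self]

theorem hom_le (X : QCat Q) : (T.obj X).hom ≤ (barExt T (Dist.id X)).rel := by
  rw [rel_eq]; exact (T.map (yoneda X)).map_le

theorem flat (hT : PreservesYonedaFF T) (X : QCat Q) :
    (barExt T (Dist.id X)).rel = (T.obj X).hom := by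
  rw [rel_eq]; exact (hT X).symm

theorem lower_le (hT : IsTwoFunctor T) (f : X ⟶ Y) :
    (Dist.lower (T.map f)).rel ≤ (barExt T (Dist.lower f)).rel := by
  have h : yoneda X ≤ f ≫ transpose (Dist.lower f) := by
    rw [QCat.le_iff]
    have h1 : restrict (yoneda X).base (presheaf X).hom (f ≫ transpose (Dist.lower f)).base =
        restrict f.base Y.hom f.base := by
      rw [QCat.comp_base, ← Category.id_comp (yoneda X).base, ← restrict_restrict,
        yoneda_restrict, restrict_id_left]
      exact comp_assoc _ _ _
    rw [h1]
    exact X.id_le.trans f.map_le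
  have h2 := QCat.graph_comp_le_of_le (hT _ _ h)
  rw [rel_eq, restrict, ← comp_assoc, ← comp_graph_le_iff]
  refine le_trans ?_ h2
  rw [T.map_comp, QCat.comp_base, graph_comp]
  change (graph _ ⨟ QCat.hom _) ⨟ graph _ ≤ _
  rw [comp_assoc, comp_assoc]
  exact comp_mono le_rfl (comp_graph_le_graph_comp_iff.2 (T.map _).map_le)

theorem restrict_right (φ : Dist X Y) (g : Z ⟶ Y) :
    (barExt T (restrictDist (𝟙 X) φ g)).rel = (barExt T φ).rel ⨟ cograph (T.map g).base := by
  rw [rel_eq, rel_eq, transpose_restrictDist_right, T.map_comp, QCat.comp_base, restrict,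
    restrict, cograph_comp]
  simp only [comp_assoc]

theorem upper_le (f : X ⟶ Y) :
    (Dist.upper (T.map f)).rel ≤ (barExt T (Dist.upper f)).rel := by
  have h : Dist.upper f = restrictDist (𝟙 Y) (Dist.id Y) f :=
    Dist.ext (restrict_id_left _ _).symm
  rw [h, restrict_right]
  exact comp_mono (hom_le Y) le_rfl

theorem restrict_left (hT : IsTwoFunctor T) (f : W ⟶ X) (φ : Dist X Y) :
    (barExt T (restrictDist f φ (𝟙 Y))).rel = graph (T.map f).base ⨟ (barExt T φ).rel := by
  have hl : restrictDist f φ (𝟙 Y) = (Dist.lower f).comp φ := by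
    apply Dist.ext
    change restrict _ _ (𝟙 _) = (graph _ ⨟ QCat.hom _) ⨟ _
    rw [restrict_id_right, comp_assoc, φ.hom_comp_rel]
  apply le_antisymm
  · rw [← cograph_comp_le_iff]
    have h1 : cograph (T.map f).base ≤ (barExt T (Dist.upper f)).rel := by
      refine le_trans ?_ (upper_le f)
      calc cograph (T.map f).base = QRel.id _ ⨟ cograph (T.map f).base := (id_comp _).symm
        _ ≤ _ := comp_mono (QCat.id_le _) le_rfl
    refine (comp_mono h1 le_rfl).trans ((comp_le _ _).trans (mono hT ?_))
    change (QCat.hom _ ⨟ cograph _) ⨟ restrict _ _ (𝟙 _) ≤ _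
    rw [restrict_id_right, comp_assoc]
    calc _ ≤ X.hom ⨟ φ.rel := comp_mono le_rfl ((cograph_comp_le_iff _ _ _).2 le_rfl)
      _ = φ.rel := φ.hom_comp_rel
  · rw [hl]
    refine le_trans (comp_mono ?_ le_rfl) (comp_le _ _)
    refine le_trans ?_ (lower_le hT f)
    calc graph (T.map f).base = graph (T.map f).base ⨟ QRel.id _ := (comp_id _).symm
      _ ≤ _ := comp_mono le_rfl (QCat.id_le _)

theorem restrict_rel (hT : IsTwoFunctor T) (f : W ⟶ X) (φ : Dist X Y) (g : Z ⟶ Y) :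
    (barExt T (restrictDist f φ g)).rel =
      restrict (T.map f).base (barExt T φ).rel (T.map g).base := by
  have h : restrictDist f φ g = restrictDist (𝟙 W) (restrictDist f φ (𝟙 Y)) g := by
    apply Dist.ext
    change restrict _ _ _ = restrict (𝟙 _) (restrict _ _ (𝟙 _)) _
    rw [restrict_restrict, Category.id_comp, Category.comp_id]
  rw [h, restrict_right, restrict_left hT, restrict, comp_assoc]

end barExt

/-! ### The functor `Γ'` -/

namespace Gamma

open barExt

/-- The lax extension `T̂ = o 𝒯̄ d` of `T = o 𝒯 d`. -/
def laxExt (T : QCat Q ⥤ QCat Q) (hT : IsTwoFunctor T) :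
    LaxExt (dFunctor Q ⋙ T ⋙ oFunctor Q) where
  map r := (barExt T (dRel r)).rel
  map_mono h := mono hT h
  id_le_map_id X := (QCat.id_le _).trans (hom_le ((dFunctor Q).obj X))
  map_comp_map_le r s := comp_le (dRel r) (dRel s)
  graph_le {X Y} f := by
    have h : dRel (graph f) = Dist.lower ((dFunctor Q).map f) := Dist.ext (comp_id _).symm
    rw [h]
    refine le_trans ?_ (lower_le hT _)
    exact (comp_id _).ge.trans (comp_mono le_rfl (QCat.id_le _))
  cograph_le {X Y} f := by
    have h : dRel (cograph f) = Dist.upper ((dFunctor Q).map f) := Dist.ext (id_comp _).symm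
    rw [h]
    refine le_trans ?_ (upper_le _)
    exact (id_comp _).ge.trans (comp_mono (QCat.id_le _) le_rfl)

/-- The unit of a monad on `Q`-Cat, as a `Q`-functor `X → 𝒯 X`. -/
def unit (T : Monad (QCat Q)) (X : QCat Q) : X ⟶ T.obj X := T.η.app X

theorem unit_naturality (T : Monad (QCat Q)) {X Y : QCat Q} (f : X ⟶ Y) :
    f ≫ unit T Y = unit T X ≫ T.map f := T.η.naturality f

theorem le_restrict_unit (T : Monad (QCat Q)) {X Y : QCat Q} (φ : Dist X Y) :
    φ.rel ≤ restrict (unit T X).base (barExt T.toFunctor φ).rel (unit T Y).base := by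
  rw [rel_eq, restrict_restrict, ← QCat.comp_base, ← QCat.comp_base, ← unit_naturality,
    ← unit_naturality, QCat.comp_base, QCat.comp_base, ← restrict_restrict]
  exact (yoneda_restrict φ).ge.trans (restrict_mono _ (unit T _).map_le _)

/-- The multiplication `𝒯 d o 𝒯 d X → 𝒯 d X` before application of `o`. -/
def mult (T : Monad (QCat Q)) (X : Over Q) :
    T.obj ((dFunctor Q).obj (T.obj ((dFunctor Q).obj X)).base) ⟶ T.obj ((dFunctor Q).obj X) :=
  T.map (counit (T.obj ((dFunctor Q).obj X))) ≫ T.μ.app ((dFunctor Q).obj X)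

/-- The discretization `(o 𝒯 d, o m d · o 𝒯 ε 𝒯 d, o e d)` of a monad on `Q`-Cat. -/
def monad (T : Monad (QCat Q)) : Monad (Over Q) where
  toFunctor := dFunctor Q ⋙ T.toFunctor ⋙ oFunctor Q
  η :=
    { app := fun X => (unit T ((dFunctor Q).obj X)).base
      naturality := fun _ _ f =>
        congrArg QCat.Hom.base (T.η.naturality ((dFunctor Q).map f)) }
  μ :=
    { app := fun X => (mult T X).base
      naturality := fun X Y f => by
        have h : T.map ((dFunctor Q).map (T.map ((dFunctor Q).map f)).base) ≫ mult T Y =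
            mult T X ≫ T.map ((dFunctor Q).map f) := by
          rw [mult, mult, ← Category.assoc, ← T.map_comp, counit_naturality, T.map_comp,
            Category.assoc, Category.assoc, T.mu_naturality]
        exact congrArg QCat.Hom.base h }
  assoc X := by
    have h : T.map ((dFunctor Q).map (mult T X).base) ≫ mult T X =
        mult T (T.obj ((dFunctor Q).obj X)).base ≫ mult T X := by
      have h1 : T.map ((dFunctor Q).map (mult T X).base) ≫
          T.map (counit (T.obj ((dFunctor Q).obj X))) =
          T.map (counit _) ≫ T.map (mult T X) := by
        rw [← T.map_comp, counit_naturality, T.map_comp]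
      conv_lhs => rw [mult.eq_1 T X, ← Category.assoc]
      rw [mult.eq_1 T X] at h1
      rw [h1]
      simp only [mult, Functor.map_comp, Category.assoc, Monad.assoc]
      rw [← Monad.mu_naturality_assoc]
    exact congrArg QCat.Hom.base h
  left_unit X := by
    have h : unit T ((dFunctor Q).obj (T.obj ((dFunctor Q).obj X)).base) ≫ mult T X =
        counit (T.obj ((dFunctor Q).obj X)) := by
      have h1 : unit T (T.obj ((dFunctor Q).obj X)) ≫ T.μ.app ((dFunctor Q).obj X) = 𝟙 _ :=
        T.left_unit _
      rw [mult, ← Category.assoc, ← unit_naturality, Category.assoc, h1, Category.comp_id]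
    exact congrArg QCat.Hom.base h
  right_unit X := by
    have h : T.map ((dFunctor Q).map (unit T ((dFunctor Q).obj X)).base) ≫ mult T X = 𝟙 _ := by
      rw [mult, ← Category.assoc, ← T.map_comp, counit_naturality, T.map_comp]
      refine (congrArg (fun k => k ≫ T.μ.app ((dFunctor Q).obj X)) ?_).trans
        (T.right_unit ((dFunctor Q).obj X))
      rw [← T.map_comp]
      exact congrArg T.map (Category.id_comp (unit T ((dFunctor Q).obj X)))
    exact congrArg QCat.Hom.base h

theorem isMonadExt (T : Monad (QCat Q)) (hT : ffYProperty Q T) :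
    LaxExt.IsMonadExt (T := monad T) (laxExt T.toFunctor hT.1) where
  eta {X Y} r := by
    exact comp_graph_le_graph_comp_iff.2 (le_restrict_unit T (dRel r))
  mu {X Y} r := by
    change (barExt T.toFunctor (dRel (barExt T.toFunctor (dRel r)).rel)).rel ⨟
      graph (mult T Y).base ≤ graph (mult T X).base ⨟ (barExt T.toFunctor (dRel r)).rel
    have h1 : dRel (barExt T.toFunctor (dRel r)).rel =
        restrictDist (counit _) (barExt T.toFunctor (dRel r)) (counit _) :=
      Dist.ext (restrict_id _).symm
    have h2 : barExt T.toFunctor (dRel r) = restrictDist (T.map (yoneda _)) (Dist.id _)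
        (T.map (transpose (dRel r))) := Dist.ext (rel_eq _)
    have h3 : (barExt T.toFunctor (barExt T.toFunctor (dRel r))).rel ≤
        restrict (T.μ.app _).base (barExt T.toFunctor (dRel r)).rel (T.μ.app _).base := by
      rw [rel_eq (dRel r), restrict_restrict, ← QCat.comp_base, ← QCat.comp_base,
        ← T.mu_naturality, ← T.mu_naturality, h2, restrict_rel hT.1, flat hT.2,
        QCat.comp_base, QCat.comp_base, ← restrict_restrict]
      exact restrict_mono _ (T.μ.app _).map_le _
    rw [comp_graph_le_graph_comp_iff, h1, restrict_rel hT.1]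
    refine (restrict_mono _ h3 _).trans ?_
    rw [restrict_restrict]
    exact le_rfl

/-- The object assignment of `Γ'`. -/
def obj (T : FFYMnd Q) : ExtMnd Q where
  monad := monad T.obj
  ext := laxExt T.obj.toFunctor T.property.1
  isMonadExt := isMonadExt T.obj T.property

/-- The monad morphism with components `o κ_{d X}`. -/
def monadHom {S T : Monad (QCat Q)} (κ : S ⟶ T) : monad S ⟶ monad T where
  app X := (κ.app ((dFunctor Q).obj X)).base
  naturality X Y f := congrArg QCat.Hom.base (κ.naturality ((dFunctor Q).map f))
  app_η X := congrArg QCat.Hom.base (κ.app_η ((dFunctor Q).obj X))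
  app_μ X := by
    have h : mult S X ≫ κ.app ((dFunctor Q).obj X) =
        (S.map ((dFunctor Q).map (κ.app ((dFunctor Q).obj X)).base) ≫
          κ.app ((dFunctor Q).obj (T.obj ((dFunctor Q).obj X)).base)) ≫ mult T X := by
      have h1 := κ.naturality (counit (T.obj ((dFunctor Q).obj X)))
      have h2 : S.map ((dFunctor Q).map (κ.app ((dFunctor Q).obj X)).base) ≫
          S.map (counit (T.obj ((dFunctor Q).obj X))) =
          S.map (counit _) ≫ S.map (κ.app ((dFunctor Q).obj X)) := by
        rw [← S.map_comp, counit_naturality, S.map_comp]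
      rw [mult, mult, Category.assoc, Category.assoc, ← Category.assoc (κ.app _), ← h1,
        Category.assoc, ← Category.assoc (S.map ((dFunctor Q).map _)), h2, κ.app_μ]
      simp only [Category.assoc]
    exact congrArg QCat.Hom.base h

theorem oplax {S T : FFYMnd Q} (κ : S ⟶ T) {X Y : Over Q} (r : QRel X Y) :
    (obj S).ext.map r ⨟ graph ((monadHom κ.hom).app Y) ≤
      graph ((monadHom κ.hom).app X) ⨟ (obj T).ext.map r := by
  change (barExt S.obj.toFunctor (dRel r)).rel ⨟ graph (κ.hom.app ((dFunctor Q).obj Y)).base ≤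
    graph (κ.hom.app ((dFunctor Q).obj X)).base ⨟ (barExt T.obj.toFunctor (dRel r)).rel
  rw [comp_graph_le_graph_comp_iff, rel_eq, rel_eq, restrict_restrict, ← QCat.comp_base,
    ← QCat.comp_base, ← κ.hom.naturality, ← κ.hom.naturality, QCat.comp_base, QCat.comp_base,
    ← restrict_restrict]
  exact restrict_mono _ (κ.hom.app _).map_le _

end Gamma

variable (Q) in
/-- The discretization functor `Γ' : ffYMnd(Q-Cat) ⥤ ExtMnd(Set/Q₀)`. -/
def GammaFunctor : FFYMnd Q ⥤ ExtMnd Q where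
  obj := Gamma.obj
  map κ := ⟨Gamma.monadHom κ.hom, Gamma.oplax κ⟩
  map_id _ := rfl
  map_comp _ _ := rfl

end

end Quantaloid

/-! Both composites reduce to computations with restrictions `g^∘ ∘ r ∘ f_∘`. A lax extension
commutes strictly with restriction along maps (`LaxExt.map_restrict`), and the Yoneda lemma presents
`r : X ⇸ Y` as the restriction of the hom of `P(dX)` along the Yoneda `Q`-functor and the transpose
of `r` (`yoneda_restrict`). Applying `T̂` to this presentation shows that `Γ'` recovers `T̂` from
`Δ' (T, T̂)` (`Delta.barExt_functor_dRel`). The monad is recovered as well, so `Γ' Δ'` is the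
identity on objects. This makes `Δ'` injective on objects; the transformation with identity
components is then an invertible unit, which makes `Δ'` full and faithful.

The counit at a 2-monad `𝒯` has the components `𝒯 ε_X`. For these to be `Q`-functors on `(o𝒯dX, 𝒯̄
a)`, full fidelity of `𝒯 y_X` is needed: `a` is the restriction of the identity distributor of `(X,
a)` along `ε_X`, the assignment `𝒯̄` commutes with restriction along `Q`-functors, and `𝒯̄` sends
the identity distributor to the hom of `𝒯 X` because `𝒯 y_X` is fully faithful
(`Gamma.barExt_dRel_hom`). The remaining laws are naturality squares at `ε`, and the triangle
identities hold because `ε` is carried by identity maps. -/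

namespace Quantaloid

noncomputable section

variable {Q : Type u} [SmallCategory Q] [Quantaloid Q]

/-! ### Strict equality of monads with lax extension -/

namespace ExtMnd

/-- The monad laws and the extension laws are propositions, so only the data matter. The types of
unit, multiplication and extension all depend on the endofunctor, hence the heterogeneous
equalities; they become ordinary ones once the functors are identified. -/
theorem eq_of_data {E F : ExtMnd Q} (hT : E.monad.toFunctor = F.monad.toFunctor)
    (hη : HEq E.monad.η F.monad.η) (hμ : HEq E.monad.μ F.monad.μ) (hext : HEq E.ext F.ext) :
    E = F := by
  obtain ⟨⟨T, η, μ, _, _, _⟩, e, _⟩ := E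
  obtain ⟨⟨T', η', μ', _, _, _⟩, e', _⟩ := F
  dsimp only at hT hη hμ hext
  subst hT
  cases hη
  cases hμ
  cases hext
  rfl

end ExtMnd

/-! ### The composite `Γ' Δ'` and the unit -/

namespace Delta

/-- The extension induced by `Δ' E` on discrete `Q`-categories is the original one. -/
theorem barExt_functor_dRel (E : ExtMnd Q) {X Y : Over Q} (r : QRel X Y) :
    (barExt (functor E) (dRel r)).rel = E.ext.map r := by
  rw [barExt.rel_eq]
  -- The hom of `Δ' E` at the presheaf category is `T̂` of the presheaf hom, so `T̂` can be pulled
  -- outside the restriction, where the Yoneda lemma applies.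
  exact (E.ext.map_restrict _ _ _).symm.trans (congrArg E.ext.map (yoneda_restrict (dRel r)))

/-- The multiplication of `Γ' Δ' E` carries the extra factor `T ε`, which is `T` of an identity map.
The two multiplications therefore agree, though not definitionally. -/
theorem mult_base (E : ExtMnd Q) (X : Over Q) :
    (Gamma.mult (monad E) X).base = E.monad.μ.app X := by
  change E.monad.map (𝟙 _) ≫ E.monad.μ.app X = _
  rw [E.monad.map_id]
  exact Category.id_comp _

/-- Strict equality, rather than an isomorphism, is what injectivity on objects requires. The unit
of the adjunction is built separately with explicit identity components, which avoids transport
along this equality. -/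
theorem gamma_obj_delta_obj (E : ExtMnd Q) :
    (GammaFunctor Q).obj ((DeltaFunctor Q).obj E) = E := by
  -- Endofunctor and unit agree definitionally; only multiplication and extension need an argument.
  refine ExtMnd.eq_of_data rfl HEq.rfl (heq_of_eq ?_) (heq_of_eq ?_)
  · apply NatTrans.ext
    funext X
    exact mult_base E X
  · apply LaxExt.ext
    funext X Y r
    exact barExt_functor_dRel E r

/-- The unit `E → Γ' (Δ' E)`, with identity components. -/
def toGammaDelta (E : ExtMnd Q) : E ⟶ (GammaFunctor Q).obj ((DeltaFunctor Q).obj E) where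
  hom :=
    { app := fun X => 𝟙 (E.monad.obj X)
      naturality := fun _ _ f => (Category.comp_id _).trans (Category.id_comp (E.monad.map f)).symm
      app_η := fun _ => Category.comp_id _
      app_μ := fun X => by
        -- With identity components, the horizontal composite in the multiplication law collapses,
        -- leaving only the comparison `mult_base`.
        have h : (E.monad.map (𝟙 _) ≫ 𝟙 _) ≫ E.monad.μ.app X = E.monad.μ.app X := by
          rw [E.monad.map_id, Category.comp_id]
          exact Category.id_comp _
        exact (Category.comp_id _).trans
          (h.symm.trans (congrArg ((E.monad.map (𝟙 _) ≫ 𝟙 _) ≫ ·) (mult_base E X).symm)) }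
  oplax {X Y} r := by
    rw [comp_graph_le_graph_comp_iff]
    exact ((restrict_id _).trans (barExt_functor_dRel E r)).ge

/-- The inverse `Γ' (Δ' E) → E` of the unit. -/
def ofGammaDelta (E : ExtMnd Q) : (GammaFunctor Q).obj ((DeltaFunctor Q).obj E) ⟶ E where
  hom :=
    { app := fun X => 𝟙 (E.monad.obj X)
      naturality := fun _ _ f => (Category.comp_id _).trans (Category.id_comp (E.monad.map f)).symm
      app_η := fun _ => Category.comp_id _
      app_μ := fun X => by
        have h : (E.monad.map (𝟙 _) ≫ 𝟙 _) ≫ E.monad.μ.app X = E.monad.μ.app X := by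
          rw [E.monad.map_id, Category.comp_id]
          exact Category.id_comp _
        exact (Category.comp_id _).trans ((mult_base E X).trans h.symm) }
  oplax {X Y} r := by
    rw [comp_graph_le_graph_comp_iff]
    -- The two extensions are equal, not merely comparable, so the identity components are oplax in
    -- this direction too.
    exact (barExt_functor_dRel E r).le.trans (restrict_id _).ge

/-- The isomorphism `E ≅ Γ' (Δ' E)`. -/
def gammaDeltaIso (E : ExtMnd Q) : E ≅ (GammaFunctor Q).obj ((DeltaFunctor Q).obj E) where
  hom := toGammaDelta E
  inv := ofGammaDelta E
  hom_inv_id := ExtMnd.hom_ext <| MonadHom.ext <| funext fun X =>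
    Category.comp_id (𝟙 (E.monad.obj X))
  inv_hom_id := ExtMnd.hom_ext <| MonadHom.ext <| funext fun X =>
    Category.comp_id (𝟙 (E.monad.obj X))

end Delta

/-! ### The counit and the role of full fidelity -/

namespace Gamma

/-- On the underlying `Q`-relation of a `Q`-category, the extension `o 𝒯̄ d` restricts the
structure of `𝒯 X` along `𝒯 ε`. -/
theorem barExt_dRel_hom {T : QCat Q ⥤ QCat Q} (hT : IsTwoFunctor T) (hY : PreservesYonedaFF T)
    (X : QCat Q) : (barExt T (dRel X.hom)).rel =
      restrict (T.map (counit X)).base (T.obj X).hom (T.map (counit X)).base := by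
  -- Reading `a` as a distributor `dX ⇸ dX` forgets the structure of `X`; writing it as a
  -- restriction along `ε` brings back the identity distributor of `X`, on which `barExt.flat` can
  -- use full fidelity.
  have h : dRel X.hom = barExt.restrictDist (counit X) (Dist.id X) (counit X) :=
    Dist.ext (restrict_id X.hom).symm
  rw [h, barExt.restrict_rel hT, barExt.flat hY]

/-- This is the multiplication law for the counit before `o` is applied. Naturality of `ε` at `𝒯
ε_X` and naturality of `μ` at `ε_X` bring both sides to `𝒯 ε ≫ 𝒯 𝒯 ε_X ≫ μ_X`. -/
theorem mult_comp_map_counit (T : Monad (QCat Q)) (X : QCat Q) :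
    mult T X.base ≫ T.map (counit X) =
      (T.map ((dFunctor Q).map (T.map (counit X)).base) ≫ T.map (counit (T.obj X))) ≫
        T.μ.app X := by
  rw [← T.map_comp, counit_naturality, T.map_comp, mult, Category.assoc, Category.assoc]
  exact congrArg (T.map (counit _) ≫ ·) (T.μ.naturality (counit X)).symm

/-- The counit `Δ' (Γ' T) → T`, with components carried by `𝒯 ε`. -/
def fromDelta (T : FFYMnd Q) : Delta.monad (obj T) ⟶ T.obj where
  -- The equality makes these components fully faithful; being a `Q`-functor uses only one
  -- inequality.
  app X := ⟨(T.obj.map (counit X)).base, (barExt_dRel_hom T.property.1 T.property.2 X).le⟩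
  naturality X Y f := by
    apply QCat.hom_ext
    have h : T.obj.map ((dFunctor Q).map f.base) ≫ T.obj.map (counit Y) =
        T.obj.map (counit X) ≫ T.obj.map f := by
      rw [← T.obj.map_comp, counit_naturality, T.obj.map_comp]
    have h' := congrArg QCat.Hom.base h
    exact h'
  app_η X := by
    apply QCat.hom_ext
    -- Naturality of the unit at `ε_X` leaves a factor `ε_X`, whose underlying map is an identity.
    have h := congrArg QCat.Hom.base (unit_naturality T.obj (counit X)).symm
    exact h.trans (Category.id_comp _)
  app_μ X := by
    apply QCat.hom_ext
    have h := congrArg QCat.Hom.base (mult_comp_map_counit T.obj X)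
    exact h

end Gamma

/-! ### The adjunction and its consequences -/

variable (Q) in
/-- The adjunction `Δ' ⊣ Γ'`. -/
def deltaGammaAdjunction : DeltaFunctor Q ⊣ GammaFunctor Q :=
  Adjunction.mkOfUnitCounit
    { unit :=
        { app := Delta.toGammaDelta
          naturality := fun _ _ f => ExtMnd.hom_ext <| MonadHom.ext <| funext fun X =>
            (Category.comp_id (f.hom.app X)).trans (Category.id_comp (f.hom.app X)).symm }
      counit :=
        { app := fun T => ObjectProperty.homMk (Gamma.fromDelta T)
          naturality := fun _ _ κ => ObjectProperty.hom_ext _ <| MonadHom.ext <|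
            funext fun X => QCat.hom_ext <| by
              -- The component of `Δ' Γ' κ` at `X` is carried by `κ` at the discrete category on
              -- `X`, so the required square is naturality of `κ` at `ε_X`.
              have h := congrArg QCat.Hom.base (κ.hom.naturality (counit X)).symm
              exact h }
      left_triangle := by
        ext E : 2
        apply ObjectProperty.hom_ext
        apply MonadHom.ext
        funext X
        apply QCat.hom_ext
        -- On underlying maps the counit at `Δ' E` is `T` applied to the identity map carrying
        -- `ε_X`.
        change 𝟙 (E.monad.obj X.base) ≫ E.monad.map (𝟙 X.base) = 𝟙 _
        rw [E.monad.map_id, Category.comp_id]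
      right_triangle := by
        ext T : 2
        apply ExtMnd.hom_ext
        apply MonadHom.ext
        funext X
        -- `Γ'` evaluates the counit at discrete categories only, where `ε` is itself the identity
        -- `Q`-functor.
        exact (Category.id_comp _).trans
          (congrArg QCat.Hom.base (T.obj.map_id ((dFunctor Q).obj X))) }

instance (E : ExtMnd Q) : IsIso ((deltaGammaAdjunction Q).unit.app E) :=
  (Delta.gammaDeltaIso E).isIso_hom

instance : IsIso (deltaGammaAdjunction Q).unit :=
  NatIso.isIso_of_isIso_app _

/-- An invertible unit would give this only up to isomorphism; the strict left inverse `Γ'` on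
objects gives it on the nose. -/
theorem deltaFunctor_obj_injective : Function.Injective (DeltaFunctor Q).obj :=
  Function.LeftInverse.injective (g := (GammaFunctor Q).obj) Delta.gamma_obj_delta_obj

end

end Quantaloid

theorem mainTheorem1 (Q : Type u) [SmallCategory Q] [Quantaloid Q] :
    (Quantaloid.DeltaFunctor Q).Full ∧ (Quantaloid.DeltaFunctor Q).Faithful ∧
      Function.Injective (Quantaloid.DeltaFunctor Q).obj ∧
      Nonempty (Quantaloid.DeltaFunctor Q ⊣ Quantaloid.GammaFunctor Q) :=
  -- A left adjoint with invertible unit is fully faithful.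
  ⟨(Quantaloid.deltaGammaAdjunction Q).fullyFaithfulLOfIsIsoUnit.full,
    (Quantaloid.deltaGammaAdjunction Q).fullyFaithfulLOfIsIsoUnit.faithful,
    Quantaloid.deltaFunctor_obj_injective, ⟨Quantaloid.deltaGammaAdjunction Q⟩⟩
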